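/- Let $\alpha\in(0,1)$ and let $\mu$ be a probability measure on $\mathbb{Z}_+=\{0,1,2,\dots\}$ such that $\mu(\{x:x>t\})=t^{-\alpha}L(t)$ for all $t>0$, where $L$ is slowly varying at infinity, i.e. $\lim_{t\to\infty}L(xt)/L(t)=1$ for every $x>0$. Put $V(t)=t^{\alpha}/L(t)$, $V^{\leftarrow}(t)=\inf\{s\ge 0: V(s)>t\}$ and $a_n=1/V^{\leftarrow}(n)$. Let $X_1,X_2,\dots$ be i.i.d. random variables with distribution $\mu$. Then $a_n\in(0,1]$ for all sufficiently large $n$, and $$a_n\circ\sum_{i=1}^n X_i\ \xrightarrow{d}\ DS_\alpha(\alpha)\qquad\text{as } n\to\infty .$$ Here, for $\gamma\in[0,1]$ and a $\mathbb{Z}_+$-valued random variable $S$, the thinned variable $\gamma\circ S$ is any random variable distributed as $\sum_{i=1}^{S}\epsilon_i$, where $\epsilon_1,\epsilon_2,\dots$ are i.i.d., independent of $S$, with $P(\epsilon_i=1)=1-P(\epsilon_i=0)=\gamma$; and, for $\eta\ge 0$, $DS_\alpha(\eta)$ denotes the discrete stable distribution, i.e. the probability distribution on $\mathbb{Z}_+$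 (which exists for $\eta=\alpha$, as part of the claim) with probability generating function $\exp\{-\eta\frac{\Gamma(1-\alpha)}{\alpha}(1-s)^{\alpha}\}$ for $|s|\le 1$. -/

import Mathlib

open MeasureTheory ProbabilityTheory Filter Topology

/-- `f` is regularly varying (at infinity) with index `β`:
`f (x t) / f t → x ^ β` as `t → ∞`, for every `x > 0`. -/
def RegularlyVarying (f : ℝ → ℝ) (β : ℝ) : Prop :=
  ∀ x : ℝ, 0 < x → Tendsto (fun t : ℝ => f (x * t) / f t) atTop (𝓝 (x ^ β))

/-- The function `V t = t ^ α / L t`. -/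
noncomputable def tailRecip (α : ℝ) (L : ℝ → ℝ) (t : ℝ) : ℝ :=
  t ^ α / L t

/-- The generalized inverse `V^←(t) = inf {s ≥ 0 : V s > t}`. -/
noncomputable def genInverse (V : ℝ → ℝ) (t : ℝ) : ℝ :=
  sInf {s : ℝ | 0 ≤ s ∧ t < V s}

/-- The normalizing constants `a_t = 1 / V^←(t)`, where `V t = t ^ α / L t`. -/
noncomputable def scaling (α : ℝ) (L : ℝ → ℝ) (t : ℝ) : ℝ :=
  1 / genInverse (tailRecip α L) t

/-- The law of the thinned variable `γ ∘ S`, where `S` has law `ν` on the nonnegative integers: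
the law of `∑_{i=1}^S ε_i`, with `ε_1, ε_2, …` i.i.d. Bernoulli variables (equal to `1` with
probability `γ` and to `0` with probability `1 - γ`) that are independent of `S`. -/
noncomputable def thinnedLaw (γ : unitInterval) (ν : Measure ℕ) : Measure ℕ :=
  (ν.prod (Measure.infinitePi fun _ : ℕ => bernoulliMeasure (1 : ℕ) 0 γ)).map
    fun p : ℕ × (ℕ → ℕ) => ∑ i ∈ Finset.range p.1, p.2 i

/-- `ν` is the discrete stable law `DS_α(η)`: the probability measure on the nonnegative integers
with probability generating function `s ↦ exp (-η (Γ(1-α)/α) (1-s)^α)`, `|s| ≤ 1`. -/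
def IsDiscreteStable (α η : ℝ) (ν : Measure ℕ) : Prop :=
  IsProbabilityMeasure ν ∧
    ∀ s : ℝ, |s| ≤ 1 →
      ∫ k : ℕ, s ^ k ∂ν = Real.exp (-(η * (Real.Gamma (1 - α) / α) * (1 - s) ^ α))

/-! Let `G` be the generating function of `μ`, `T` its tail and `b = V^←(v)`. Thinning by `γ`
replaces `s` by `1 - γ(1 - s)`, so the thinned sum has generating function `G(1 - a_n(1 - s))^n`. It
suffices that `v(1 - G(1 - u/b)) → Γ(1-α) u^α` with `u = 1 - s` (`tendsto_mul_one_sub_pgf`): the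
n-th power then tends to `exp(-Γ(1-α) u^α)`. Writing `1 - G(r) = (1 - r) ∫ r^⌊t⌋ T(t) dt` and
substituting `t = yb` gives `v(1 - G(1 - u/b)) = u ∫ (1 - u/b)^⌊yb⌋ · v T(yb) dy`. The integrand
tends to `e^{-uy} y^{-α}` because `v T(b) → 1` (`tendsto_mul_natTail_genInverse`), and a Potter
bound dominates it (`exists_mul_natTail_le`). The limit function tends to 1 at `s = 1`, so the
continuity theorem `exists_tendsto_of_tendsto_pgf` yields both the existence of the discrete stable
law and the convergence. -/

/-! ### Generating functions and weak convergence on ℕ. -/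

lemma integrable_pow_nat (ν : Measure ℕ) [IsFiniteMeasure ν] {s : ℝ} (hs : |s| ≤ 1) :
    Integrable (fun k : ℕ => s ^ k) ν := by
  refine Integrable.of_bound (measurable_of_countable _).aestronglyMeasurable 1 (ae_of_all _ ?_)
  intro k
  rw [Real.norm_eq_abs, abs_pow]
  exact pow_le_one₀ (abs_nonneg s) hs

lemma tendsto_pgf_of_tendsto {ι : Type*} {l : Filter ι} {ν : ι → ProbabilityMeasure ℕ}
    {ν₀ : ProbabilityMeasure ℕ} (h : Tendsto ν l (𝓝 ν₀)) {s : ℝ} (hs : |s| ≤ 1) :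
    Tendsto (fun i => ∫ k : ℕ, s ^ k ∂(ν i : Measure ℕ)) l (𝓝 (∫ k : ℕ, s ^ k ∂(ν₀ : Measure ℕ))) :=
  ProbabilityMeasure.tendsto_iff_forall_integral_tendsto.1 h
    (BoundedContinuousFunction.ofNormedAddCommGroup (fun k : ℕ => s ^ k)
      continuous_of_discreteTopology 1 fun k => by
        rw [Real.norm_eq_abs, abs_pow]
        exact pow_le_one₀ (abs_nonneg s) hs)

lemma summable_measureReal_singleton (ν : Measure ℕ) [IsFiniteMeasure ν] :
    Summable fun k : ℕ => ν.real {k} := by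
  refine ENNReal.summable_toReal ?_
  have h : ∑' k, ν {k} = ν Set.univ := by rw [← lintegral_one, lintegral_countable']; simp
  exact h ▸ measure_ne_top _ _

/-- A probability measure on `ℕ` is determined by its probability generating function. -/
lemma ProbabilityMeasure.ext_of_pgf {ν ν' : ProbabilityMeasure ℕ}
    (h : ∀ s : ℝ, |s| ≤ 1 → ∫ k : ℕ, s ^ k ∂(ν : Measure ℕ) = ∫ k : ℕ, s ^ k ∂(ν' : Measure ℕ)) :
    ν = ν' := by
  have key : ∀ s : ℝ, |s| ≤ 1 → HasSum (fun k : ℕ => s ^ k •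
      ((ν : Measure ℕ).real {k} - (ν' : Measure ℕ).real {k})) 0 := by
    intro s hs
    have aux : ∀ ρ : ProbabilityMeasure ℕ, HasSum (fun k : ℕ => (ρ : Measure ℕ).real {k} • s ^ k)
        (∫ k : ℕ, s ^ k ∂(ρ : Measure ℕ)) := by
      intro ρ
      have hi := integrable_pow_nat (ρ : Measure ℕ) hs
      rw [integral_countable hi]
      refine Summable.hasSum ?_
      refine Summable.of_norm_bounded (g := fun k => (ρ : Measure ℕ).real {k})
        (summable_measureReal_singleton (ρ : Measure ℕ)) fun k => ?_
      rw [norm_smul, Real.norm_eq_abs, Real.norm_eq_abs, abs_pow, abs_of_nonneg measureReal_nonneg]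
      exact mul_le_of_le_one_right measureReal_nonneg (pow_le_one₀ (abs_nonneg s) hs)
    have := (aux ν).sub (aux ν')
    rw [h s hs, sub_self] at this
    refine this.congr_fun fun k => ?_
    simp only [smul_eq_mul]; ring
  set p : FormalMultilinearSeries ℝ ℝ ℝ := fun n => ContinuousMultilinearMap.mkPiRing ℝ (Fin n)
    ((ν : Measure ℕ).real {n} - (ν' : Measure ℕ).real {n}) with hp
  have hc : ∀ n, p.coeff n = (ν : Measure ℕ).real {n} - (ν' : Measure ℕ).real {n} := by
    intro n
    simp [hp, FormalMultilinearSeries.coeff]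
  -- A power series with sum zero near 0 has zero coefficients.
  have h0 : p = 0 := by
    refine HasFPowerSeriesAt.eq_zero (x := 0) (hasFPowerSeriesAt_iff.2 ?_)
    filter_upwards [Metric.closedBall_mem_nhds (0 : ℝ) one_pos] with z hz
    simp only [hc]
    exact key z (by simpa using hz)
  apply Subtype.ext
  refine Measure.ext_of_singleton fun n => ?_
  have hn := hc n
  rw [h0] at hn
  simp only [FormalMultilinearSeries.coeff, FormalMultilinearSeries.zero_apply,
    _root_.zero_apply] at hn
  exact (measureReal_eq_measureReal_iff (measure_ne_top (ν : Measure ℕ) _)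
    (measure_ne_top (ν' : Measure ℕ) _)).1 (sub_eq_zero.1 hn.symm)

/-- Markov's inequality for the increasing function `k ↦ 1 - s ^ k`. -/
lemma measureReal_Ici_mul_le_one_sub_pgf (ν : Measure ℕ) [IsProbabilityMeasure ν] {s : ℝ}
    (hs0 : 0 ≤ s) (hs1 : s ≤ 1) (K : ℕ) :
    ν.real (Set.Ici K) * (1 - s ^ K) ≤ 1 - ∫ k : ℕ, s ^ k ∂ν := by
  have hi := integrable_pow_nat ν (s := s) (by rwa [abs_of_nonneg hs0])
  have h1 : 1 - ∫ k : ℕ, s ^ k ∂ν = ∫ k : ℕ, (1 - s ^ k) ∂ν := by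
    rw [integral_sub (integrable_const _) hi]; simp
  have h2 : ν.real (Set.Ici K) * (1 - s ^ K)
      = ∫ k : ℕ, (Set.Ici K).indicator (fun _ => 1 - s ^ K) k ∂ν := by
    rw [integral_indicator_const _ (measurableSet_Ici), smul_eq_mul]
  rw [h1, h2]
  refine integral_mono ((integrable_const _).indicator measurableSet_Ici)
    ((integrable_const _).sub hi) fun k => ?_
  by_cases hk : k ∈ Set.Ici K
  · rw [Set.indicator_of_mem hk]
    exact sub_le_sub_left (pow_le_pow_of_le_one hs0 hs1 hk) 1
  · rw [Set.indicator_of_notMem hk]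
    exact sub_nonneg.2 (pow_le_one₀ hs0 hs1)

lemma isTightMeasureSet_of_tendsto_pgf {ν : ℕ → ProbabilityMeasure ℕ} {G : ℝ → ℝ}
    (h : ∀ s : ℝ, |s| ≤ 1 → Tendsto (fun n => ∫ k : ℕ, s ^ k ∂(ν n : Measure ℕ)) atTop (𝓝 (G s)))
    (hG : Tendsto G (𝓝[<] 1) (𝓝 1)) :
    IsTightMeasureSet {x : Measure ℕ | ∃ ρ ∈ Set.range ν, (ρ : Measure ℕ) = x} := by
  rw [isTightMeasureSet_iff_exists_isCompact_measure_compl_le]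
  intro ε hε
  obtain ⟨δ, hδ0, hδε⟩ := ENNReal.lt_iff_exists_nnreal_btwn.1 hε
  have hδ : (0 : ℝ) < δ := by exact_mod_cast hδ0
  -- With `1 - G s < δ/2` and `s ^ K < 1/2`, the Markov bound makes the mass of `[K, ∞)` at most `δ`
  -- for all large `n`; the finitely many other laws are tight one by one.
  obtain ⟨s, hsG, hs⟩ : ∃ s, 1 - δ / 2 < G s ∧ s ∈ Set.Ioo (0 : ℝ) 1 :=
    ((hG.eventually_const_lt (by linarith : 1 - (δ : ℝ) / 2 < 1)).and
      (Ioo_mem_nhdsLT (by norm_num : (0 : ℝ) < 1))).exists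
  obtain ⟨K, hK⟩ := exists_pow_lt_of_lt_one (by norm_num : (0 : ℝ) < 1 / 2) hs.2
  have hev := (h s (abs_le.2 ⟨by linarith [hs.1], hs.2.le⟩)).eventually_const_lt hsG
  obtain ⟨N, hN⟩ := eventually_atTop.1 hev
  have hsing : ∀ n, ∃ C : Set ℕ, IsCompact C ∧ (ν n : Measure ℕ) Cᶜ ≤ ε := fun n => by
    obtain ⟨C, hC, hC'⟩ := isTightMeasureSet_iff_exists_isCompact_measure_compl_le.1
      (isTightMeasureSet_singleton (μ := (ν n : Measure ℕ))) ε hε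
    exact ⟨C, hC, hC' _ rfl⟩
  choose C hC hC' using hsing
  refine ⟨(⋃ n ∈ Finset.range N, C n) ∪ Set.Iio K,
    ((Finset.range N).isCompact_biUnion fun n _ => hC n).union (Set.finite_Iio K).isCompact, ?_⟩
  rintro _ ⟨_, ⟨n, rfl⟩, rfl⟩
  rcases lt_or_ge n N with hn | hn
  · refine (measure_mono (Set.compl_subset_compl.2 ?_)).trans (hC' n)
    exact (Set.subset_biUnion_of_mem (u := C) (Finset.mem_coe.2 (Finset.mem_range.2 hn))).trans
      Set.subset_union_left
  · refine (measure_mono (t := Set.Ici K) ?_).trans (le_trans ?_ hδε.le)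
    · intro k hk
      simp only [Set.compl_union, Set.mem_inter_iff, Set.mem_compl_iff, Set.mem_Iio, not_lt] at hk
      exact hk.2
    · have h1 := measureReal_Ici_mul_le_one_sub_pgf (ν n : Measure ℕ) hs.1.le hs.2.le K
      have h2 := hN n hn
      have h3 : (ν n : Measure ℕ).real (Set.Ici K) ≤ δ := by
        have h0 : 0 ≤ (ν n : Measure ℕ).real (Set.Ici K) := measureReal_nonneg
        nlinarith
      rw [measureReal_def] at h3
      rw [← ENNReal.ofReal_coe_nnreal]
      exact (ENNReal.le_ofReal_iff_toReal_le (measure_ne_top _ _) hδ.le).2 h3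

/-- **Continuity theorem for probability generating functions.** -/
theorem exists_tendsto_of_tendsto_pgf {ν : ℕ → ProbabilityMeasure ℕ} {G : ℝ → ℝ}
    (h : ∀ s : ℝ, |s| ≤ 1 → Tendsto (fun n => ∫ k : ℕ, s ^ k ∂(ν n : Measure ℕ)) atTop (𝓝 (G s)))
    (hG : Tendsto G (𝓝[<] 1) (𝓝 1)) :
    ∃ ν₀ : ProbabilityMeasure ℕ, Tendsto ν atTop (𝓝 ν₀) ∧
      ∀ s : ℝ, |s| ≤ 1 → ∫ k : ℕ, s ^ k ∂(ν₀ : Measure ℕ) = G s := by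
  have hcomp := isCompact_closure_of_isTightMeasureSet (isTightMeasureSet_of_tendsto_pgf h hG)
  have hmem : ∀ n, ν n ∈ closure (Set.range ν) := fun n => subset_closure ⟨n, rfl⟩
  have hpgf : ∀ ρ : ProbabilityMeasure ℕ, MapClusterPt ρ atTop ν →
      ∀ s : ℝ, |s| ≤ 1 → ∫ k : ℕ, s ^ k ∂(ρ : Measure ℕ) = G s := by
    intro ρ hρ s hs
    obtain ⟨U, hU, hUρ⟩ := mapClusterPt_iff_ultrafilter.1 hρ
    exact tendsto_nhds_unique (tendsto_pgf_of_tendsto hUρ hs) ((h s hs).mono_left hU)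
  obtain ⟨ν₀, -, hν₀⟩ := hcomp.exists_mapClusterPt (f := atTop) (u := ν)
    (tendsto_principal.2 (Eventually.of_forall hmem))
  refine ⟨ν₀, ?_, hpgf ν₀ hν₀⟩
  -- Every cluster point has generating function `G`, so there is only one; by compactness the
  -- sequence converges to it.
  refine hcomp.tendsto_nhds_of_unique_mapClusterPt (Eventually.of_forall hmem) fun ρ _ hρ => ?_
  exact ProbabilityMeasure.ext_of_pgf fun s hs => by rw [hpgf ρ hρ s hs, hpgf ν₀ hν₀ s hs]

/-! ### Generating functions of thinned laws and sums, and their expression by the tail. -/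

/-- The probability generating function of a thinned law. -/
lemma pgf_thinnedLaw (γ : unitInterval) (ν : Measure ℕ) [IsProbabilityMeasure ν] {s : ℝ}
    (hs : |s| ≤ 1) :
    ∫ k : ℕ, s ^ k ∂(thinnedLaw γ ν) = ∫ k : ℕ, (1 - γ * (1 - s)) ^ k ∂ν := by
  have hmeas : Measurable fun p : ℕ × (ℕ → ℕ) => ∑ i ∈ Finset.range p.1, p.2 i := by
    refine measurable_from_prod_countable_right fun n => ?_
    change Measurable fun ω : ℕ → ℕ => ∑ i ∈ Finset.range n, ω i
    exact Finset.measurable_fun_sum (f := fun (i : ℕ) (ω : ℕ → ℕ) => ω i) _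
      fun i _ => measurable_pi_apply i
  have hint : Integrable (fun p : ℕ × (ℕ → ℕ) => s ^ (∑ i ∈ Finset.range p.1, p.2 i))
      (ν.prod (Measure.infinitePi fun _ : ℕ => bernoulliMeasure (1 : ℕ) 0 γ)) := by
    refine Integrable.of_bound ((measurable_of_countable _).comp hmeas).aestronglyMeasurable 1
      (ae_of_all _ fun p => ?_)
    rw [Real.norm_eq_abs, abs_pow]
    exact pow_le_one₀ (abs_nonneg s) hs
  rw [thinnedLaw, integral_map hmeas.aemeasurable
    (measurable_of_countable _).aestronglyMeasurable, integral_prod _ hint]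
  refine integral_congr_ae (ae_of_all _ fun n => ?_)
  have hind : iIndepFun (fun (i : Fin n) (ω : ℕ → ℕ) => ω i)
      (Measure.infinitePi fun _ : ℕ => bernoulliMeasure (1 : ℕ) 0 γ) :=
    (iIndepFun_infinitePi (P := fun _ : ℕ => bernoulliMeasure (1 : ℕ) 0 γ)
      (X := fun _ k => k) fun _ => measurable_id).precomp Fin.val_injective
  have hprod := hind.integral_fun_prod_comp (𝕜 := ℝ) (f := fun _ k => s ^ k)
    (fun i => (measurable_pi_apply _).aemeasurable)
    (fun i => (measurable_of_countable _).aestronglyMeasurable)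
  have hone : ∀ i : ℕ, ∫ ω : ℕ → ℕ, s ^ (ω i)
      ∂(Measure.infinitePi fun _ : ℕ => bernoulliMeasure (1 : ℕ) 0 γ) = 1 - γ * (1 - s) := by
    intro i
    rw [← integral_map (φ := fun ω : ℕ → ℕ => ω i) (f := fun k : ℕ => s ^ k)
      (measurable_pi_apply _).aemeasurable (measurable_of_countable _).aestronglyMeasurable,
      (measurePreserving_eval_infinitePi _ i).map_eq, integral_bernoulliMeasure]
    simp only [pow_one, pow_zero, smul_eq_mul]
    ring
  simp only [hone, Finset.prod_const, Finset.card_univ, Fintype.card_fin] at hprod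
  rw [← hprod]
  refine integral_congr_ae (ae_of_all _ fun ω => ?_)
  simp only [Finset.prod_pow_eq_pow_sum]
  rw [Finset.sum_range]

/-- The probability generating function of a sum of i.i.d. variables. -/
lemma pgf_map_sum_range {Ω : Type*} [MeasurableSpace Ω] {P : Measure Ω} {μ : Measure ℕ}
    {X : ℕ → Ω → ℕ} (hX : ∀ i, HasLaw (X i) μ P) (hindep : iIndepFun X P) (n : ℕ) (r : ℝ) :
    ∫ k : ℕ, r ^ k ∂(P.map fun ω => ∑ i ∈ Finset.range n, X i ω) = (∫ k : ℕ, r ^ k ∂μ) ^ n := by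
  have hae : AEMeasurable (fun ω => ∑ i ∈ Finset.range n, X i ω) P :=
    Finset.aemeasurable_fun_sum _ fun i _ => (hX i).aemeasurable
  rw [integral_map hae (measurable_of_countable _).aestronglyMeasurable]
  have hind : iIndepFun (fun i : Fin n => X i) P := hindep.precomp Fin.val_injective
  have hprod := hind.integral_fun_prod_comp (𝕜 := ℝ) (f := fun _ k => r ^ k)
    (fun i => (hX i).aemeasurable) (fun i => (measurable_of_countable _).aestronglyMeasurable)
  have hone : ∀ i : ℕ, ∫ ω, r ^ (X i ω) ∂P = ∫ k : ℕ, r ^ k ∂μ := by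
    intro i
    rw [← (hX i).map_eq, integral_map (hX i).aemeasurable
      (measurable_of_countable _).aestronglyMeasurable]
  simp only [hone, Finset.prod_const, Finset.card_univ, Fintype.card_fin] at hprod
  rw [← hprod]
  refine integral_congr_ae (ae_of_all _ fun ω => ?_)
  simp only [Finset.prod_pow_eq_pow_sum]
  rw [Finset.sum_range]

/-- Supplies the density whose primitive at `k` is `1 - r ^ k`, for use in the layer-cake formula.
-/
lemma integral_pow_floor_zero_natCast (r : ℝ) (k : ℕ) :
    ∫ t in (0 : ℝ)..k, (1 - r) * r ^ ⌊t⌋₊ = 1 - r ^ k ∧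
      IntervalIntegrable (fun t : ℝ => (1 - r) * r ^ ⌊t⌋₊) volume 0 k := by
  have hae : ∀ i : ℕ, ∀ t ∈ Set.Ioo (i : ℝ) (i + 1), (1 - r) * r ^ ⌊t⌋₊ = (1 - r) * r ^ i := by
    intro i t ht
    rw [(Nat.floor_eq_iff ((Nat.cast_nonneg i).trans ht.1.le)).2 ⟨ht.1.le, ht.2⟩]
  have hii : ∀ i : ℕ, IntervalIntegrable (fun t : ℝ => (1 - r) * r ^ ⌊t⌋₊) volume i (i + 1) := by
    intro i
    refine (intervalIntegrable_const (c := (1 - r) * r ^ i)).congr_uIoo fun t ht => ?_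
    rw [Set.uIoo_of_le (by linarith)] at ht
    exact (hae i t ht).symm
  induction k with
  | zero => simp
  | succ k ih =>
    push_cast
    refine ⟨?_, ih.2.trans (hii k)⟩
    rw [← intervalIntegral.integral_add_adjacent_intervals ih.2 (hii k), ih.1,
      intervalIntegral.integral_of_le (by linarith), integral_Ioc_eq_integral_Ioo,
      setIntegral_congr_fun measurableSet_Ioo (hae k), setIntegral_const,
      Real.volume_real_Ioo_of_le (by linarith)]
    simp only [smul_eq_mul]
    ring

/-- The probability generating function in terms of the tail. -/
lemma one_sub_pgf_eq_integral_tail (μ : Measure ℕ) [IsProbabilityMeasure μ] {r : ℝ}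
    (hr0 : 0 ≤ r) (hr1 : r ≤ 1) :
    1 - ∫ k : ℕ, r ^ k ∂μ =
      (1 - r) * ∫ t in Set.Ioi (0 : ℝ), r ^ ⌊t⌋₊ * μ.real {k : ℕ | t < (k : ℝ)} := by
  have hi := integrable_pow_nat μ (s := r) (by rwa [abs_of_nonneg hr0])
  have hg0 : ∀ t : ℝ, 0 ≤ (1 - r) * r ^ ⌊t⌋₊ := fun t =>
    mul_nonneg (sub_nonneg.2 hr1) (pow_nonneg hr0 _)
  have hgm : Measurable fun t : ℝ => (1 - r) * r ^ ⌊t⌋₊ :=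
    ((measurable_of_countable fun k : ℕ => r ^ k).comp Nat.measurable_floor).const_mul _
  have hgi : ∀ t > (0 : ℝ), IntervalIntegrable (fun t : ℝ => (1 - r) * r ^ ⌊t⌋₊) volume 0 t := by
    intro t ht
    refine (integral_pow_floor_zero_natCast r ⌈t⌉₊).2.mono_set ?_
    rw [Set.uIcc_of_le ht.le, Set.uIcc_of_le (Nat.cast_nonneg _)]
    exact Set.Icc_subset_Icc_right (Nat.le_ceil t)
  have hlc := lintegral_comp_eq_lintegral_meas_lt_mul μ (f := fun k : ℕ => (k : ℝ))
    (g := fun t : ℝ => (1 - r) * r ^ ⌊t⌋₊) (ae_of_all _ fun k => Nat.cast_nonneg k)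
    (measurable_of_countable _).aemeasurable hgi (ae_of_all _ hg0)
  simp only [(integral_pow_floor_zero_natCast r _).1] at hlc
  have hanti : Antitone fun t : ℝ => μ.real {k : ℕ | t < (k : ℝ)} := fun s t hst =>
    measureReal_mono fun k (hk : t < k) => hst.trans_lt hk
  have h1 : 1 - ∫ k : ℕ, r ^ k ∂μ = ∫ k : ℕ, (1 - r ^ k) ∂μ := by
    rw [integral_sub (integrable_const _) hi]; simp
  rw [h1, ← integral_const_mul, integral_eq_lintegral_of_nonneg_ae
    (ae_of_all _ fun k => sub_nonneg.2 (pow_le_one₀ hr0 hr1))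
    (measurable_of_countable _).aestronglyMeasurable, hlc, integral_eq_lintegral_of_nonneg_ae
    (ae_of_all _ fun t => mul_nonneg (sub_nonneg.2 hr1)
      (mul_nonneg (pow_nonneg hr0 _) measureReal_nonneg))]
  · congr 1
    refine lintegral_congr fun t => ?_
    rw [← mul_assoc, ENNReal.ofReal_mul (hg0 t), ofReal_measureReal, mul_comm]
  · have := hgm.mul hanti.measurable
    simp only [← mul_assoc]
    exact this.aestronglyMeasurable

/-! ### The tail of `μ` and the generalized inverse. -/

/-- The tail function `t ↦ μ (t, ∞)` of a measure on the nonnegative integers. -/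
noncomputable def natTail (μ : Measure ℕ) (t : ℝ) : ℝ :=
  μ.real {k : ℕ | t < (k : ℝ)}

section natTail

variable {μ : Measure ℕ}

lemma antitone_natTail [IsProbabilityMeasure μ] : Antitone (natTail μ) := fun _ _ hst =>
  measureReal_mono fun _ hk => lt_of_le_of_lt hst hk

lemma natTail_nonneg (t : ℝ) : 0 ≤ natTail μ t := measureReal_nonneg

lemma natTail_le_one [IsProbabilityMeasure μ] (t : ℝ) : natTail μ t ≤ 1 := measureReal_le_one

/-- No integer lies in `(b, s]`. This plays the role of right-continuity of the tail. -/
lemma natTail_eq_of_lt_floor_add_one {b s : ℝ} (hb : 0 ≤ b) (hbs : b ≤ s) (hs : s < ⌊b⌋₊ + 1) :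
    natTail μ s = natTail μ b := by
  unfold natTail
  congr 1
  ext k
  refine ⟨fun hk => lt_of_le_of_lt hbs hk, fun hk => ?_⟩
  have h1 : ⌊b⌋₊ < k := (Nat.floor_lt hb).2 hk
  have h2 : ((⌊b⌋₊ + 1 : ℕ) : ℝ) ≤ k := by exact_mod_cast h1
  push_cast at h2
  exact lt_of_lt_of_le hs h2

lemma tendsto_natTail_atTop [IsProbabilityMeasure μ] : Tendsto (natTail μ) atTop (𝓝 0) := by
  have h := tendsto_measure_iInter_atTop (μ := μ) (s := fun t : ℝ => {k : ℕ | t < (k : ℝ)})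
    (fun _ => MeasurableSet.of_discrete.nullMeasurableSet)
    (fun _ _ hst _ hk => lt_of_le_of_lt hst hk) ⟨0, measure_ne_top _ _⟩
  have he : ⋂ t : ℝ, {k : ℕ | t < (k : ℝ)} = ∅ := by
    ext k
    simp only [Set.mem_iInter, Set.mem_ofPred_eq, Set.mem_empty_iff_false, iff_false, not_forall,
      not_lt]
    exact ⟨k, le_rfl⟩
  rw [he, measure_empty] at h
  exact (ENNReal.tendsto_toReal ENNReal.zero_ne_top).comp h

end natTail

section scaling

variable {α : ℝ} {μ : Measure ℕ} {L : ℝ → ℝ}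

lemma tendsto_natTail_ratio (hL : RegularlyVarying L 0)
    (hμ : ∀ t : ℝ, 0 < t → natTail μ t = t ^ (-α) * L t) {x : ℝ} (hx : 0 < x) :
    Tendsto (fun t => natTail μ (x * t) / natTail μ t) atTop (𝓝 (x ^ (-α))) := by
  have h := (hL x hx).const_mul (x ^ (-α))
  rw [Real.rpow_zero, mul_one] at h
  refine h.congr' ?_
  filter_upwards [eventually_gt_atTop 0] with t ht
  rw [hμ _ (mul_pos hx ht), hμ t ht, Real.mul_rpow hx.le ht.le]
  have := (Real.rpow_pos_of_pos ht (-α)).ne'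
  rw [mul_assoc, mul_left_comm, mul_div_mul_left _ _ this, mul_div_assoc]

/-- At a zero of the tail the ratio for `x = 1` would be `0 / 0 = 0`, against its limit 1. So the
tail is positive arbitrarily far out, hence everywhere by monotonicity. -/
lemma natTail_pos [IsProbabilityMeasure μ] (hL : RegularlyVarying L 0)
    (hμ : ∀ t : ℝ, 0 < t → natTail μ t = t ^ (-α) * L t) (t : ℝ) : 0 < natTail μ t := by
  have h := tendsto_natTail_ratio hL hμ one_pos
  rw [Real.one_rpow] at h
  obtain ⟨s, hs, hts⟩ := ((h.eventually_const_lt one_half_lt_one).and (eventually_ge_atTop t)).exists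
  refine lt_of_lt_of_le (lt_of_le_of_ne (natTail_nonneg s) fun h0 => ?_) (antitone_natTail hts)
  rw [← h0, div_zero] at hs
  linarith

lemma tailRecip_eq_inv_natTail (hμ : ∀ t : ℝ, 0 < t → natTail μ t = t ^ (-α) * L t) {t : ℝ}
    (ht : 0 < t) : tailRecip α L t = (natTail μ t)⁻¹ := by
  rw [hμ t ht, tailRecip, Real.rpow_neg ht.le, mul_inv, inv_inv, div_eq_mul_inv]

lemma lt_tailRecip_iff [IsProbabilityMeasure μ] (hα : 0 < α) (hL : RegularlyVarying L 0)
    (hμ : ∀ t : ℝ, 0 < t → natTail μ t = t ^ (-α) * L t) {u : ℝ} (hu : 0 < u) {s : ℝ} :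
    s ∈ {s : ℝ | 0 ≤ s ∧ u < tailRecip α L s} ↔ 0 < s ∧ natTail μ s < u⁻¹ := by
  have key : ∀ s, 0 < s → (u < tailRecip α L s ↔ natTail μ s < u⁻¹) := fun s hs => by
    rw [tailRecip_eq_inv_natTail hμ hs, lt_inv_comm₀ hu (natTail_pos hL hμ s)]
  constructor
  · rintro ⟨h0, h⟩
    rcases h0.eq_or_lt with rfl | h0
    · rw [tailRecip, Real.zero_rpow hα.ne', zero_div] at h
      linarith
    · exact ⟨h0, (key s h0).1 h⟩
  · rintro ⟨h0, h⟩
    exact ⟨h0.le, (key s h0).2 h⟩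

lemma nonempty_lt_tailRecip [IsProbabilityMeasure μ] (hα : 0 < α) (hL : RegularlyVarying L 0)
    (hμ : ∀ t : ℝ, 0 < t → natTail μ t = t ^ (-α) * L t) {u : ℝ} (hu : 0 < u) :
    {s : ℝ | 0 ≤ s ∧ u < tailRecip α L s}.Nonempty := by
  obtain ⟨s, hs, hs0⟩ := (((tendsto_natTail_atTop (μ := μ)).eventually_lt_const (inv_pos.2 hu)).and
    (eventually_gt_atTop 0)).exists
  exact ⟨s, (lt_tailRecip_iff hα hL hμ hu).2 ⟨hs0, hs⟩⟩

lemma bddBelow_lt_tailRecip (u : ℝ) : BddBelow {s : ℝ | 0 ≤ s ∧ u < tailRecip α L s} :=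
  ⟨0, fun _ hs => hs.1⟩

/-- The strict inequality survives at the infimum since the tail is constant just to its right. -/
lemma natTail_genInverse_lt [IsProbabilityMeasure μ] (hα : 0 < α) (hL : RegularlyVarying L 0)
    (hμ : ∀ t : ℝ, 0 < t → natTail μ t = t ^ (-α) * L t) {u : ℝ} (hu : 0 < u) :
    natTail μ (genInverse (tailRecip α L) u) < u⁻¹ := by
  have hne := nonempty_lt_tailRecip hα hL hμ hu
  set b := genInverse (tailRecip α L) u with hb
  have hb0 : 0 ≤ b := Real.sInf_nonneg fun s hs => hs.1
  obtain ⟨s, hs, hsb⟩ := exists_lt_of_csInf_lt hne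
    (show sInf {s : ℝ | 0 ≤ s ∧ u < tailRecip α L s} < ⌊b⌋₊ + 1 from Nat.lt_floor_add_one b)
  rw [← natTail_eq_of_lt_floor_add_one hb0 (csInf_le (bddBelow_lt_tailRecip u) hs) hsb]
  exact ((lt_tailRecip_iff hα hL hμ hu).1 hs).2

lemma inv_le_natTail_of_lt_genInverse [IsProbabilityMeasure μ] (hα : 0 < α) (hL : RegularlyVarying L 0)
    (hμ : ∀ t : ℝ, 0 < t → natTail μ t = t ^ (-α) * L t) {u : ℝ} (hu : 0 < u) {s : ℝ} (hs : 0 < s)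
    (hsb : s < genInverse (tailRecip α L) u) : u⁻¹ ≤ natTail μ s := by
  by_contra! h
  exact absurd (csInf_le (bddBelow_lt_tailRecip u) ((lt_tailRecip_iff hα hL hμ hu).2 ⟨hs, h⟩))
    (not_le.2 hsb)

lemma tendsto_genInverse_atTop [IsProbabilityMeasure μ] (hα : 0 < α) (hL : RegularlyVarying L 0)
    (hμ : ∀ t : ℝ, 0 < t → natTail μ t = t ^ (-α) * L t) :
    Tendsto (genInverse (tailRecip α L)) atTop atTop := by
  refine tendsto_atTop.2 fun M => ?_
  have hM := natTail_pos (μ := μ) hL hμ M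
  filter_upwards [eventually_gt_atTop 0, eventually_ge_atTop (natTail μ M)⁻¹] with u hu huM
  refine le_csInf (nonempty_lt_tailRecip hα hL hμ hu) fun s hs => ?_
  have hs' := ((lt_tailRecip_iff hα hL hμ hu).1 hs).2
  by_contra! hsM
  have h1 : natTail μ M < u⁻¹ := (antitone_natTail hsM.le).trans_lt hs'
  rw [lt_inv_comm₀ hM hu] at h1
  linarith

lemma eventually_scaling_mem_Ioc [IsProbabilityMeasure μ] (hα : 0 < α) (hL : RegularlyVarying L 0)
    (hμ : ∀ t : ℝ, 0 < t → natTail μ t = t ^ (-α) * L t) :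
    ∀ᶠ u in atTop, scaling α L u ∈ Set.Ioc (0 : ℝ) 1 := by
  filter_upwards [(tendsto_genInverse_atTop hα hL hμ).eventually_ge_atTop 1] with u hu
  exact ⟨one_div_pos.2 (by linarith), (div_le_one (by linarith)).2 hu⟩

lemma tendsto_mul_natTail_genInverse [IsProbabilityMeasure μ] (hα : 0 < α) (hL : RegularlyVarying L 0)
    (hμ : ∀ t : ℝ, 0 < t → natTail μ t = t ^ (-α) * L t) {y : ℝ} (hy : 0 < y) :
    Tendsto (fun u => u * natTail μ (y * genInverse (tailRecip α L) u)) atTop (𝓝 (y ^ (-α))) := by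
  have hb := tendsto_genInverse_atTop (μ := μ) hα hL hμ
  have hone : Tendsto (fun u => u * natTail μ (genInverse (tailRecip α L) u)) atTop (𝓝 1) := by
    -- Lower bound: for `x < 1`, `T(xb) ≥ 1/u`, so `u T(b) ≥ T(b)/T(xb) → x^α`, and `x` may be taken
    -- close to 1. Upper bound: `T(b) < 1/u`.
    refine tendsto_order.2 ⟨fun c hc => ?_, fun c hc => ?_⟩
    · have hcont : Tendsto (fun x : ℝ => x ^ α) (𝓝[<] 1) (𝓝 1) := by
        have := (Real.continuousAt_rpow_const 1 α (Or.inl one_ne_zero)).tendsto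
        rw [Real.one_rpow] at this
        exact this.mono_left nhdsWithin_le_nhds
      obtain ⟨x, hxc, hx0, hx1⟩ := ((hcont.eventually_const_lt hc).and
        (Ioo_mem_nhdsLT (zero_lt_one' ℝ))).exists
      have h1 := ((tendsto_natTail_ratio hL hμ hx0).inv₀
        (Real.rpow_pos_of_pos hx0 _).ne').comp hb
      rw [Real.rpow_neg hx0.le, inv_inv] at h1
      filter_upwards [h1.eventually_const_lt hxc, eventually_gt_atTop 0,
        hb.eventually_gt_atTop 0] with u hu hu0 hbu
      refine hu.trans_le ?_
      have h2 := inv_le_natTail_of_lt_genInverse hα hL hμ hu0 (mul_pos hx0 hbu)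
        (by nlinarith : x * genInverse (tailRecip α L) u < genInverse (tailRecip α L) u)
      simp only [Function.comp_apply, inv_div]
      rw [div_le_iff₀ (natTail_pos hL hμ _), mul_right_comm]
      refine le_mul_of_one_le_left (natTail_nonneg _) ?_
      rwa [inv_le_iff_one_le_mul₀' hu0] at h2
    · filter_upwards [eventually_gt_atTop 0] with u hu
      have := natTail_genInverse_lt (μ := μ) hα hL hμ hu
      rw [lt_inv_comm₀ (natTail_pos hL hμ _) hu, ← one_div, lt_div_iff₀ (natTail_pos hL hμ _)] at this
      linarith
  have h := ((tendsto_natTail_ratio hL hμ hy).comp hb).mul hone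
  rw [mul_one] at h
  refine h.congr fun u => ?_
  have := (natTail_pos (μ := μ) hL hμ (genInverse (tailRecip α L) u)).ne'
  simp only [Function.comp_apply]
  field_simp

end scaling

/-! ### Potter bound, dominated convergence and the behaviour of `1 - G` near 1. -/

/-- A Potter-type bound: a positive decreasing function `T ≤ 1` with `T (t / 2) ≤ 2 ^ β * T t` for
large `t` satisfies `T s ≤ C * (t / s) ^ β * T t` for `0 < s ≤ t` and large `t`. -/
lemma exists_potter_bound {T : ℝ → ℝ} (hT : Antitone T) (hpos : ∀ t, 0 < T t) (hle : ∀ t, T t ≤ 1)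
    {β t₀ : ℝ} (hβ : 0 ≤ β) (ht₀ : 0 < t₀) (h : ∀ t, t₀ ≤ t → T (2⁻¹ * t) ≤ 2 ^ β * T t) :
    ∃ C : ℝ, 0 < C ∧ ∀ s t : ℝ, 0 < s → s ≤ t → t₀ ≤ t → T s ≤ C * (t / s) ^ β * T t := by
  -- The first term serves `t ≤ 2 t₀`, where `T s ≤ 1 ≤ C * T t`; the second serves `t / 2 < s ≤ t`.
  -- Otherwise `t` is halved, by induction on its dyadic scale.
  set C := max (T (2 * t₀))⁻¹ (2 ^ β) with hC
  have hC0 : 0 < C := lt_max_of_lt_left (inv_pos.2 (hpos _))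
  refine ⟨C, hC0, ?_⟩
  have key : ∀ n : ℕ, ∀ s t : ℝ, 0 < s → s ≤ t → t₀ ≤ t → t ≤ 2 ^ (n + 1) * t₀ →
      T s ≤ C * (t / s) ^ β * T t := by
    intro n
    induction n with
    | zero =>
      intro s t hs hst ht htn
      have h1 : 1 ≤ (t / s) ^ β := Real.one_le_rpow ((one_le_div hs).2 hst) hβ
      have h2 : 1 ≤ C * T t := by
        have : (T (2 * t₀))⁻¹ * T (2 * t₀) ≤ C * T t :=
          mul_le_mul (le_max_left _ _) (hT (by simpa using htn)) (hpos _).le hC0.le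
        rwa [inv_mul_cancel₀ (hpos _).ne'] at this
      calc T s ≤ 1 := hle s
        _ ≤ (C * T t) * (t / s) ^ β := one_le_mul_of_one_le_of_one_le h2 h1
        _ = _ := by ring
    | succ n ih =>
      intro s t hs hst ht htn
      rcases le_or_gt t (2 * t₀) with h2 | h2
      · refine ih s t hs hst ht (h2.trans ?_)
        refine mul_le_mul_of_nonneg_right ?_ ht₀.le
        exact le_self_pow₀ one_le_two (by omega)
      · have ht0 : 0 < t := ht₀.trans_le ht
        rcases le_or_gt s (2⁻¹ * t) with hs2 | hs2
        · have h3 := ih s (2⁻¹ * t) hs hs2 (by linarith) (by rw [pow_succ] at htn; linarith)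
          have h4 : (t / s) ^ β = (2⁻¹ * t / s) ^ β * 2 ^ β := by
            rw [← Real.mul_rpow (by positivity) zero_le_two]
            congr 1
            ring
          calc T s ≤ C * (2⁻¹ * t / s) ^ β * T (2⁻¹ * t) := h3
            _ ≤ C * (2⁻¹ * t / s) ^ β * (2 ^ β * T t) := by
              refine mul_le_mul_of_nonneg_left (h t ht) (by positivity)
            _ = _ := by rw [h4]; ring
        · have h1 : 1 ≤ (t / s) ^ β := Real.one_le_rpow ((one_le_div hs).2 hst) hβ
          calc T s ≤ T (2⁻¹ * t) := hT hs2.le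
            _ ≤ 2 ^ β * T t := h t ht
            _ ≤ C * T t := mul_le_mul_of_nonneg_right (le_max_right _ _) (hpos _).le
            _ ≤ (C * T t) * (t / s) ^ β :=
              le_mul_of_one_le_right (mul_nonneg hC0.le (hpos _).le) h1
            _ = _ := by ring
  intro s t hs hst ht
  obtain ⟨n, hn⟩ := pow_unbounded_of_one_lt (t / t₀) one_lt_two
  refine key n s t hs hst ht ?_
  rw [div_lt_iff₀ ht₀] at hn
  refine hn.le.trans (mul_le_mul_of_nonneg_right ?_ ht₀.le)
  exact pow_le_pow_right₀ one_le_two n.le_succ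

lemma tendsto_one_sub_div_pow_floor (u : ℝ) {y : ℝ} (hy : 0 ≤ y) :
    Tendsto (fun b : ℝ => (1 - u / b) ^ ⌊y * b⌋₊) atTop (𝓝 (Real.exp (-(u * y)))) := by
  have h := (tendsto_nat_floor_mul_div_atTop hy).mul (Real.tendsto_mul_log_one_add_div_atTop (-u))
  have he : y * -u = -(u * y) := by ring
  rw [he] at h
  refine ((Real.continuous_exp.tendsto _).comp h).congr' ?_
  filter_upwards [eventually_gt_atTop 0, eventually_gt_atTop u] with b hb hbu
  have h1 : 0 < 1 - u / b := sub_pos.2 ((div_lt_one hb).2 hbu)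
  simp only [Function.comp_apply]
  rw [← mul_assoc, div_mul_cancel₀ _ hb.ne', neg_div, ← sub_eq_add_neg, Real.exp_nat_mul,
    Real.exp_log h1]

/-- The factor `exp u` pays for the floor: losing at most 1 in the exponent costs `u / b ≤ u`. -/
lemma one_sub_div_pow_floor_le {u b y : ℝ} (hu : 0 ≤ u) (hb : 1 ≤ b) (hub : u ≤ b) :
    (1 - u / b) ^ ⌊y * b⌋₊ ≤ Real.exp u * Real.exp (-(u * y)) := by
  have hb0 : 0 < b := by linarith
  have h1 : 0 ≤ 1 - u / b := sub_nonneg.2 ((div_le_one hb0).2 hub)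
  calc (1 - u / b) ^ ⌊y * b⌋₊ ≤ Real.exp (-(u / b)) ^ ⌊y * b⌋₊ :=
        pow_le_pow_left₀ h1 (Real.one_sub_le_exp_neg _) _
    _ = Real.exp (⌊y * b⌋₊ * -(u / b)) := (Real.exp_nat_mul _ _).symm
    _ ≤ Real.exp (u + -(u * y)) := by
      refine Real.exp_le_exp.2 ?_
      have h2 : y * b - 1 ≤ ⌊y * b⌋₊ := (Nat.sub_one_lt_floor (y * b)).le
      have h3 : (y * b - 1) * (u / b) ≤ ⌊y * b⌋₊ * (u / b) :=
        mul_le_mul_of_nonneg_right h2 (div_nonneg hu hb0.le)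
      have h4 : (y * b - 1) * (u / b) = u * y - u / b := by field_simp
      have h5 : u / b ≤ u := div_le_self hu hb
      linarith
    _ = _ := Real.exp_add _ _

section

variable {α : ℝ} {μ : Measure ℕ} [IsProbabilityMeasure μ] {L : ℝ → ℝ}

/-- Potter's bound gives the power for `y ≤ 1`; for `y > 1` monotonicity gives 1. Taking `β > α`
leaves room for the halving inequality, as `2 ^ α < 2 ^ β`. -/
lemma exists_mul_natTail_le (hα : α ∈ Set.Ioo (0 : ℝ) 1) (hL : RegularlyVarying L 0)
    (hμ : ∀ t : ℝ, 0 < t → natTail μ t = t ^ (-α) * L t) {β : ℝ} (hβ : α < β) :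
    ∃ C : ℝ, 0 < C ∧ ∀ᶠ v in atTop, ∀ y : ℝ, 0 < y →
      v * natTail μ (y * genInverse (tailRecip α L) v) ≤ C * y ^ (-β) + 1 := by
  have hβ0 : 0 < β := hα.1.trans hβ
  have hratio := tendsto_natTail_ratio hL hμ (x := 2⁻¹) (by norm_num)
  have hlt : (2⁻¹ : ℝ) ^ (-α) < 2 ^ β := by
    rw [Real.inv_rpow zero_le_two, Real.rpow_neg zero_le_two, inv_inv]
    exact Real.rpow_lt_rpow_of_exponent_lt one_lt_two hβ
  obtain ⟨t₀, ht₀⟩ := eventually_atTop.1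
    ((hratio.eventually_lt_const hlt).and (eventually_gt_atTop 0))
  obtain ⟨C, hC, hpot⟩ := exists_potter_bound (antitone_natTail (μ := μ)) (natTail_pos hL hμ)
    natTail_le_one hβ0.le (ht₀ t₀ le_rfl).2 fun t ht =>
      ((div_lt_iff₀ (natTail_pos hL hμ t)).1 (ht₀ t ht).1).le
  refine ⟨C, hC, ?_⟩
  filter_upwards [eventually_gt_atTop 0,
    (tendsto_genInverse_atTop hα.1 hL hμ).eventually_ge_atTop t₀] with v hv hb y hy
  set b := genInverse (tailRecip α L) v
  have hb0 : 0 < b := (ht₀ b hb).2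
  have hvT : v * natTail μ b ≤ 1 := by
    have := (natTail_genInverse_lt hα.1 hL hμ hv).le
    calc v * natTail μ b ≤ v * v⁻¹ := mul_le_mul_of_nonneg_left this hv.le
      _ = 1 := mul_inv_cancel₀ hv.ne'
  have hy' : 0 ≤ C * y ^ (-β) := mul_nonneg hC.le (Real.rpow_nonneg hy.le _)
  rcases le_or_gt y 1 with h1 | h1
  · have h2 := hpot (y * b) b (mul_pos hy hb0) (mul_le_of_le_one_left hb0.le h1) hb
    have h3 : (b / (y * b)) ^ β = y ^ (-β) := by
      rw [div_mul_cancel_right₀ hb0.ne', Real.inv_rpow hy.le, Real.rpow_neg hy.le]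
    rw [h3] at h2
    calc v * natTail μ (y * b) ≤ v * (C * y ^ (-β) * natTail μ b) :=
          mul_le_mul_of_nonneg_left h2 hv.le
      _ = C * y ^ (-β) * (v * natTail μ b) := by ring
      _ ≤ C * y ^ (-β) := mul_le_of_le_one_right hy' hvT
      _ ≤ _ := by linarith
  · have h2 : natTail μ (y * b) ≤ natTail μ b :=
      antitone_natTail (le_mul_of_one_le_left hb0.le h1.le)
    have := mul_le_mul_of_nonneg_left h2 hv.le
    linarith

lemma tendsto_integral_pow_floor_mul_natTail (hα : α ∈ Set.Ioo (0 : ℝ) 1)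
    (hL : RegularlyVarying L 0) (hμ : ∀ t : ℝ, 0 < t → natTail μ t = t ^ (-α) * L t) {u : ℝ}
    (hu : 0 < u) :
    Tendsto (fun v => ∫ y in Set.Ioi (0 : ℝ), (1 - u / genInverse (tailRecip α L) v) ^
      ⌊y * genInverse (tailRecip α L) v⌋₊ * (v * natTail μ (y * genInverse (tailRecip α L) v)))
      atTop (𝓝 ((1 / u) ^ (1 - α) * Real.Gamma (1 - α))) := by
  have hb := tendsto_genInverse_atTop hα.1 hL hμ
  rw [← Real.integral_rpow_mul_exp_neg_mul_Ioi (sub_pos.2 hα.2) hu]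
  -- Midway between `α` and 1: above `α` for the Potter bound, below 1 so that `y ^ (-β)` is
  -- integrable at 0.
  set β := (1 + α) / 2 with hβ
  obtain ⟨C, hC, hbound⟩ := exists_mul_natTail_le hα hL hμ (β := β) (by linarith [hα.2])
  have hint : ∀ γ : ℝ, -1 < γ →
      IntegrableOn (fun y : ℝ => y ^ γ * Real.exp (-(u * y))) (Set.Ioi 0) := fun γ hγ => by
    simpa [neg_mul] using integrableOn_rpow_mul_exp_neg_mul_rpow hγ one_pos hu
  refine tendsto_integral_filter_of_dominated_convergence
    (fun y => Real.exp u * (C * (y ^ (-β) * Real.exp (-(u * y)))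
      + y ^ (0 : ℝ) * Real.exp (-(u * y)))) ?_ ?_ ?_ ?_
  · refine Eventually.of_forall fun v => Measurable.aestronglyMeasurable ?_
    exact ((measurable_of_countable fun k : ℕ => (1 - u / genInverse (tailRecip α L) v) ^ k).comp
      (Nat.measurable_floor.comp (measurable_id.mul_const _))).mul
      ((antitone_natTail.measurable.comp (measurable_id.mul_const _)).const_mul v)
  · filter_upwards [eventually_gt_atTop 0, hb.eventually_ge_atTop 1, hb.eventually_ge_atTop u,
      hbound] with v hv hb1 hbu hv'
    refine (ae_restrict_iff' measurableSet_Ioi).2 (ae_of_all _ fun y hy => ?_)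
    have hr : 0 ≤ 1 - u / genInverse (tailRecip α L) v :=
      sub_nonneg.2 ((div_le_one (by linarith)).2 hbu)
    rw [Real.norm_of_nonneg (mul_nonneg (pow_nonneg hr _) (mul_nonneg hv.le (natTail_nonneg _))),
      Real.rpow_zero]
    refine (mul_le_mul (one_sub_div_pow_floor_le hu.le hb1 hbu) (hv' y hy)
      (mul_nonneg hv.le (natTail_nonneg _)) (by positivity)).trans_eq ?_
    ring
  · exact (((hint _ (by rw [hβ]; linarith [hα.2])).const_mul C).add
      (hint 0 (by norm_num))).const_mul (Real.exp u)
  · refine (ae_restrict_iff' measurableSet_Ioi).2 (ae_of_all _ fun y (hy : 0 < y) => ?_)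
    have h := ((tendsto_one_sub_div_pow_floor u hy.le).comp hb).mul
      (tendsto_mul_natTail_genInverse hα.1 hL hμ hy)
    rw [mul_comm] at h
    rwa [show 1 - α - 1 = -α by ring]

/-- Near `1`, `1 - G` is regularly varying, where `G` is the probability generating function
of `μ`. -/
lemma tendsto_mul_one_sub_pgf (hα : α ∈ Set.Ioo (0 : ℝ) 1)
    (hL : RegularlyVarying L 0) (hμ : ∀ t : ℝ, 0 < t → natTail μ t = t ^ (-α) * L t) {u : ℝ}
    (hu : 0 ≤ u) :
    Tendsto (fun v => v * (1 - ∫ k : ℕ, (1 - scaling α L v * u) ^ k ∂μ)) atTop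
      (𝓝 (Real.Gamma (1 - α) * u ^ α)) := by
  rcases hu.eq_or_lt with rfl | hu
  · simp [Real.zero_rpow hα.1.ne']
  have hb := tendsto_genInverse_atTop hα.1 hL hμ
  have h := (tendsto_integral_pow_floor_mul_natTail hα hL hμ hu).const_mul u
  have he : u * ((1 / u) ^ (1 - α) * Real.Gamma (1 - α)) = Real.Gamma (1 - α) * u ^ α := by
    rw [one_div, Real.inv_rpow hu.le, ← Real.rpow_neg hu.le, ← mul_assoc, mul_comm]
    congr 1
    nth_rewrite 1 [← Real.rpow_one u]
    rw [← Real.rpow_add hu]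
    congr 1
    ring
  rw [he] at h
  refine h.congr' ?_
  filter_upwards [eventually_gt_atTop 0, hb.eventually_gt_atTop 0, hb.eventually_ge_atTop u]
    with v hv hb0 hbu
  have hs : 1 - scaling α L v * u = 1 - u / genInverse (tailRecip α L) v := by
    rw [scaling, one_div_mul_eq_div]
  rw [hs]
  set b := genInverse (tailRecip α L) v
  have hr : 0 ≤ 1 - u / b := sub_nonneg.2 ((div_le_one hb0).2 hbu)
  rw [one_sub_pgf_eq_integral_tail μ hr (sub_le_self _ (div_nonneg hu.le hb0.le))]
  have hcomp := integral_comp_mul_right_Ioi (fun t => (1 - u / b) ^ ⌊t⌋₊ * natTail μ t) 0 hb0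
  rw [zero_mul, smul_eq_mul] at hcomp
  have hlin : ∫ y in Set.Ioi (0 : ℝ), (1 - u / b) ^ ⌊y * b⌋₊ * (v * natTail μ (y * b))
      = v * ∫ y in Set.Ioi (0 : ℝ), (1 - u / b) ^ ⌊y * b⌋₊ * natTail μ (y * b) := by
    rw [← integral_const_mul]
    congr 1
    ext y
    ring
  rw [hlin, hcomp]
  change u * (v * (b⁻¹ * _)) = v * ((1 - (1 - u / b)) * ∫ t in Set.Ioi (0 : ℝ),
    (1 - u / b) ^ ⌊t⌋₊ * natTail μ t)
  ring

end

/-! ### Convergence of the thinned sums. -/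

theorem lemma10
    (α : ℝ) (hα : α ∈ Set.Ioo (0 : ℝ) 1)
    -- a probability measure on the nonnegative integers with tail `t ^ (-α) * L t`
    (μ : Measure ℕ) [IsProbabilityMeasure μ]
    (L : ℝ → ℝ) (hL : RegularlyVarying L 0)
    (hμ : ∀ t : ℝ, 0 < t → μ.real {k : ℕ | t < (k : ℝ)} = t ^ (-α) * L t)
    -- an i.i.d. sequence with law `μ`
    {Ω : Type*} [MeasurableSpace Ω] (P : Measure Ω) [IsProbabilityMeasure P]
    (X : ℕ → Ω → ℕ) (hX : ∀ i, HasLaw (X i) μ P) (hindep : iIndepFun X P)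
    -- `Y n` is a version of the thinned sum `a_n ∘ (X_1 + ⋯ + X_n)`, for all `n` for which
    -- the thinning makes sense
    {Ω' : ℕ → Type*} [∀ n, MeasurableSpace (Ω' n)]
    (P' : ∀ n, Measure (Ω' n)) [∀ n, IsProbabilityMeasure (P' n)]
    (Y : ∀ n, Ω' n → ℕ) (hYm : ∀ n, AEMeasurable (Y n) (P' n))
    (hY : ∀ n : ℕ, ∀ h : scaling α L n ∈ Set.Icc (0 : ℝ) 1,
      HasLaw (Y n)
        (thinnedLaw ⟨scaling α L n, h⟩ (P.map fun ω => ∑ i ∈ Finset.range n, X i ω)) (P' n)) :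
    -- the thinning makes sense for all large `n` (with a genuine, finite, positive `a_n`)
    (∀ᶠ n : ℕ in atTop, scaling α L n ∈ Set.Ioc (0 : ℝ) 1) ∧
    -- and the thinned sums converge in distribution to `DS_α(α)`
    ∃ ν : ProbabilityMeasure ℕ, IsDiscreteStable α α (ν : Measure ℕ) ∧
      TendstoInDistribution Y atTop (id : ℕ → ℕ) P' (ν : Measure ℕ) := by
  have hscal : ∀ᶠ n : ℕ in atTop, scaling α L n ∈ Set.Ioc (0 : ℝ) 1 :=
    tendsto_natCast_atTop_atTop.eventually (eventually_scaling_mem_Ioc hα.1 hL hμ)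
  refine ⟨hscal, ?_⟩
  set c := α * (Real.Gamma (1 - α) / α) with hc
  have hcΓ : c = Real.Gamma (1 - α) := mul_div_cancel₀ _ hα.1.ne'
  let law : ℕ → ProbabilityMeasure ℕ := fun n =>
    ⟨(P' n).map (Y n), Measure.isProbabilityMeasure_map (hYm n)⟩
  have hpgf : ∀ s : ℝ, |s| ≤ 1 → Tendsto (fun n => ∫ k : ℕ, s ^ k ∂(law n : Measure ℕ)) atTop
      (𝓝 (Real.exp (-(c * (1 - s) ^ α)))) := by
    intro s hs
    have h := ((tendsto_mul_one_sub_pgf hα hL hμ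
      (sub_nonneg.2 (abs_le.1 hs).2)).comp
        (tendsto_natCast_atTop_atTop (R := ℝ))).neg
    rw [← hcΓ] at h
    -- If `n * g n → x` then `(1 + g n) ^ n → exp x`; here `1 + g n` is `G(1 - a_n(1 - s))`.
    have h' := Real.tendsto_one_add_pow_exp_of_tendsto
      (g := fun n : ℕ => -(1 - ∫ k : ℕ, (1 - scaling α L n * (1 - s)) ^ k ∂μ))
      (h.congr fun n => by simp only [Function.comp_apply]; ring)
    refine h'.congr' ?_
    filter_upwards [hscal] with n hn
    have hlaw : (law n : Measure ℕ) = _ := (hY n ⟨hn.1.le, hn.2⟩).map_eq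
    have : IsProbabilityMeasure (P.map fun ω => ∑ i ∈ Finset.range n, X i ω) :=
      Measure.isProbabilityMeasure_map
        (Finset.aemeasurable_fun_sum _ fun i _ => (hX i).aemeasurable)
    rw [hlaw, pgf_thinnedLaw _ _ hs, pgf_map_sum_range hX hindep]
    congr 1
    ring
  have hG : Tendsto (fun s : ℝ => Real.exp (-(c * (1 - s) ^ α))) (𝓝[<] 1) (𝓝 1) := by
    have hcont : ContinuousAt (fun s : ℝ => Real.exp (-(c * (1 - s) ^ α))) 1 := by
      have : ContinuousAt (fun s : ℝ => (1 - s) ^ α) 1 :=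
        (continuousAt_const.sub continuousAt_id).rpow_const (Or.inr hα.1.le)
      fun_prop
    have := hcont.tendsto
    simp only [sub_self, Real.zero_rpow hα.1.ne', mul_zero, neg_zero, Real.exp_zero] at this
    exact this.mono_left nhdsWithin_le_nhds
  obtain ⟨ν, hν, hνG⟩ := exists_tendsto_of_tendsto_pgf hpgf hG
  refine ⟨ν, ⟨inferInstance, hνG⟩, ⟨hYm, aemeasurable_id, ?_⟩⟩
  have hid : (⟨(ν : Measure ℕ).map id, Measure.isProbabilityMeasure_map aemeasurable_id⟩ :
      ProbabilityMeasure ℕ) = ν := Subtype.ext Measure.map_id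
  rw [hid]
  exact hν
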